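/- Let $M\subseteq\mathbb{R}^n$ be open and let $V=(V_1,\dots,V_m)$ be a smooth $n\times m$ field on $M$ (columns $V_c$) generating a smooth $m$-parameter flow $\phi:M\times\mathbb{R}^m\to M$, $\phi^C(s)=\phi(s,C)$, i.e. $\phi^0=\mathrm{id}$, $\phi^{B}\circ\phi^{C}=\phi^{B+C}$ and $\partial\phi^C(s)/\partial C_c=V_c(\phi^C(s))$. Let $\Omega(0)\subset M$ be an oriented compact embedded $r$-dimensional submanifold (possibly with boundary), and $\Omega(C)=\phi^C(\Omega(0))$ with the orientation transported by $\phi^C$. Let $\rho=\rho_C$ ($C\in\mathbb{R}^m$) be a probability $r$-form on $\Omega(C)$: the family is $C^1$ jointly in the point and in $C$, up to the boundary of $\Omega(C)$ (that is, on a neighbourhood in $\mathbb{R}^m\times M$ of $\{(C,s): s\in\Omega(C)\}$), $\rho_C\ge 0$ on $\Omega(C)$ with respect to its orientation, and $\int_{\Omega(C)}\rho_C=1$ for all $C$. For a $0$-form $\beta=\beta_C(s)$, $C^1$ in the same sense, put $$\langle\beta\rangle(C)=\int_{\Omega(C)}\beta_C\,\rho_C,\qquad d\beta=\sum_{c=1}^m\Bigl(\frac{\partial\beta}{\partial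 C_c}+\nabla\beta\cdot V_c\Bigr)dC_c,\qquad \langle d\beta\rangle(C)=\sum_{c=1}^m\Bigl\langle\frac{\partial\beta}{\partial C_c}+\nabla\beta\cdot V_c\Bigr\rangle(C)\,dC_c .$$ Let $\mathcal L_V^{(C)}\rho=[\mathcal L^{(C_1)}\rho,\dots,\mathcal L^{(C_m)}\rho]^\top$ be the multiparameter Lie derivative, $\mathcal L^{(C_c)}\rho=\lim_{h\to0}\frac1h\bigl((\phi^{he_c})^{*}\rho_{C+he_c}-\rho_C\bigr)$. Then, at every point of $\Omega(C)$, for every $C$ and every $c$, this limit exists and $$\mathcal L^{(C_c)}\rho=\frac{\partial\rho}{\partial C_c}+i_{V_c}\,d\rho+d\,(i_{V_c}\rho),$$ where $d$ is the exterior derivative in $M$ at fixed $C$ (so that $\mathcal L_V^{(C)}\rho=i_V\,d\rho+d(i_V\rho)$ when $\rho$ does not depend explicitly on $C$). Moreover $d\langle\beta\rangle=\langle d\beta\rangle$ on $\mathbb{R}^m$ for every such $\beta$ if and only if $\mathcal L_V^{(C)}\rho=0$, as an $r$-form on $\Omega(C)$ (i.e. on vectors tangent to $\Omega(C)$), at each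 point of $\Omega(C)$ and for all $C$. -/

import Mathlib

open Set Topology MeasureTheory
open scoped ContDiff Manifold

/-- `n`-dimensional Euclidean space. -/
abbrev Euc (n : ℕ) : Type := EuclideanSpace ℝ (Fin n)

/-! ### Exterior calculus on an open subset of `ℝⁿ`

An `r`-form is a map `η : Euc n → Euc n [⋀^Fin r]→L[ℝ] ℝ`; its exterior derivative is Mathlib's
`extDeriv`.  A parametrised `r`-form is a family `ρ C` of `r`-forms, `C : Fin m → ℝ`. -/

/-- The term `i_U (dη)` of Cartan's formula. -/
noncomputable def interiorExtDeriv {n r : ℕ} (U : Euc n → Euc n)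
    (η : Euc n → Euc n [⋀^Fin r]→L[ℝ] ℝ) (s : Euc n) : Euc n [⋀^Fin r]→L[ℝ] ℝ :=
  (extDeriv η s).curryLeft (U s)

/-- The term `d (i_U η)` of Cartan's formula, where `i_U η = η(U, ·, …, ·)`; the interior product
of a `0`-form is zero. -/
noncomputable def extDerivInterior {n : ℕ} (U : Euc n → Euc n) :
    {r : ℕ} → (Euc n → Euc n [⋀^Fin r]→L[ℝ] ℝ) → Euc n → Euc n [⋀^Fin r]→L[ℝ] ℝ
  | 0, _ => 0
  | _ + 1, η => extDeriv (fun s => (η s).curryLeft (U s))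

/-- `φ : ℝᵐ × M → M`, `(C, s) ↦ φ C s`, is the smooth `m`-parameter flow, on the open set
`M ⊆ ℝⁿ`, of the smooth field `V` whose columns are the vector fields `V c`, `c = 1, …, m`. -/
structure IsParamFlow {n m : ℕ} (M : Set (Euc n)) (V : Fin m → Euc n → Euc n)
    (φ : (Fin m → ℝ) → Euc n → Euc n) : Prop where
  smooth_field : ∀ c, ContDiffOn ℝ ∞ (V c) M
  smooth_flow : ContDiffOn ℝ ∞ (fun q : (Fin m → ℝ) × Euc n => φ q.1 q.2) (univ ×ˢ M)
  mapsTo : ∀ C, MapsTo (φ C) M M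
  zero : ∀ s ∈ M, φ 0 s = s
  add : ∀ B C, ∀ s ∈ M, φ B (φ C s) = φ (B + C) s
  deriv : ∀ C c, ∀ s ∈ M,
    HasDerivAt (fun h : ℝ => φ (C + Pi.single c h) s) (V c (φ C s)) 0

/-- The curve `h ↦ (φ^{h e_c})^* ρ_{C + h e_c}` evaluated at `s`: the value of the parametrised
form `ρ` at the parameter `C + h e_c`, pulled back along the flow to the parameter `C`. -/
noncomputable def pullbackCurve {n m r : ℕ} (φ : (Fin m → ℝ) → Euc n → Euc n)
    (ρ : (Fin m → ℝ) → Euc n → Euc n [⋀^Fin r]→L[ℝ] ℝ) (C : Fin m → ℝ) (c : Fin m) (s : Euc n)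
    (h : ℝ) : Euc n [⋀^Fin r]→L[ℝ] ℝ :=
  (ρ (C + Pi.single c h) (φ (Pi.single c h) s)).compContinuousLinearMap
    (fderiv ℝ (φ (Pi.single c h)) s)

/-- The `c`-th component of the multiparameter Lie derivative of `ρ`, at the parameter `C` and the
point `s`: the limit of `((φ^{h e_c})^* ρ_{C + h e_c} - ρ_C) / h` as `h → 0`. -/
noncomputable def lieDeriv {n m r : ℕ} (φ : (Fin m → ℝ) → Euc n → Euc n)
    (ρ : (Fin m → ℝ) → Euc n → Euc n [⋀^Fin r]→L[ℝ] ℝ) (C : Fin m → ℝ) (c : Fin m) (s : Euc n) :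
    Euc n [⋀^Fin r]→L[ℝ] ℝ :=
  deriv (pullbackCurve φ ρ C c s) 0

/-- The partial derivative `∂ρ/∂C_c` at a fixed point `s`. -/
noncomputable def paramDeriv {n m r : ℕ}
    (ρ : (Fin m → ℝ) → Euc n → Euc n [⋀^Fin r]→L[ℝ] ℝ) (C : Fin m → ℝ) (c : Fin m) (s : Euc n) :
    Euc n [⋀^Fin r]→L[ℝ] ℝ :=
  deriv (fun h : ℝ => ρ (C + Pi.single c h) s) 0

/-- The `c`-th component of the total differential
`dβ = ∑_c (∂β/∂C_c + ∑_k (∂β/∂X_k) V_{kc}) dC_c`. -/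
noncomputable def totalDeriv {n m : ℕ} (V : Fin m → Euc n → Euc n)
    (β : (Fin m → ℝ) → Euc n → ℝ) (C : Fin m → ℝ) (c : Fin m) (s : Euc n) : ℝ :=
  fderiv ℝ (fun q : (Fin m → ℝ) × Euc n => β q.1 q.2) (C, s) (Pi.single c 1, V c s)

/-! ### Orientations and integration of forms

`N` is a compact `r`-dimensional manifold, possibly with boundary or corners. -/

/-- The family `v` is a positively oriented basis of the oriented vector space `(T, o)`. -/
def IsPosFrame {T : Type*} [AddCommGroup T] [Module ℝ T] {r : ℕ}
    (o : Orientation ℝ T (Fin r)) (v : Fin r → T) : Prop :=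
  ∃ b : Module.Basis (Fin r) ℝ T, ⇑b = v ∧ b.orientation = o

open Classical in
/-- The sign of a basis `v` of the oriented vector space `(T, o)`. -/
noncomputable def frameSign {T : Type*} [AddCommGroup T] [Module ℝ T] {r : ℕ}
    (o : Orientation ℝ T (Fin r)) (v : Fin r → T) : ℝ :=
  if IsPosFrame o v then 1 else -1

section Integration

variable {n r : ℕ} {H : Type*} [TopologicalSpace H] (I : ModelWithCorners ℝ (Euc r) H)
  {N : Type*} [TopologicalSpace N] [ChartedSpace H N]

/-- The coordinate frame at `x` of the chart of `N` around `i`. -/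
noncomputable def chartFrame (i x : N) (k : Fin r) : TangentSpace I x :=
  mfderivWithin 𝓘(ℝ, Euc r) I (extChartAt I i).symm (range I) (extChartAt I i x)
    (EuclideanSpace.single k (1 : ℝ) : Euc r)

/-- A family of orientations of the tangent spaces is an orientation of `N` when it is continuous:
its sign relative to the coordinate frame of any chart is locally constant. -/
def IsContinuousOrientation (o : ∀ x : N, Orientation ℝ (TangentSpace I x) (Fin r)) : Prop :=
  ∀ i : N, ∀ x ∈ (chartAt H i).source, ∀ᶠ y in 𝓝 x,
    (IsPosFrame (o y) (chartFrame I i y) ↔ IsPosFrame (o x) (chartFrame I i x))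

/-- The value at `x` of the pullback `j^* η`, a form on the tangent space of `N` at `x`. -/
noncomputable def pullbackAt (j : N → Euc n) (η : Euc n → Euc n [⋀^Fin r]→L[ℝ] ℝ) (x : N) :
    TangentSpace I x [⋀^Fin r]→L[ℝ] ℝ :=
  ContinuousAlternatingMap.compContinuousLinearMap (η (j x))
    (mfderiv I 𝓘(ℝ, Euc n) j x : TangentSpace I x →L[ℝ] Euc n)

variable [T2Space N] [CompactSpace N] [IsManifold I ∞ N]

variable (N) in
/-- A smooth partition of unity on `N` subordinate to the charts. -/
noncomputable def chartPartition : SmoothPartitionOfUnity N I N univ :=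
  (SmoothPartitionOfUnity.exists_isSubordinate_chartAt_source (I := I) N).choose

/-- The integral of the `r`-form `η` over the oriented compact `r`-dimensional submanifold
parametrised by `j : N → ℝⁿ`, i.e. `∫_N j^* η`, by a partition of unity; the local integrand is the
coefficient of `j^* η` in the coordinates of the chart, with the sign that compares the chart with
the orientation. -/
noncomputable def formIntegral (o : ∀ x : N, Orientation ℝ (TangentSpace I x) (Fin r))
    (j : N → Euc n) (η : Euc n → Euc n [⋀^Fin r]→L[ℝ] ℝ) : ℝ :=
  ∑ᶠ i : N, ∫ y in (extChartAt I i).target,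
    let x := (extChartAt I i).symm y
    chartPartition I N i x * frameSign (o x) (chartFrame I i x) *
      pullbackAt I j η x (chartFrame I i x)

/-- `ρ` is a probability `r`-form on the moving oriented submanifold
`Ω(C) = φ^C (Ω(0))`, `Ω(0) = ι(N)`: it is continuously differentiable in the point and the
parameter (on a neighbourhood of `{(C, s) | s ∈ Ω(C)}`), it is nonnegative on the positively
oriented frames tangent to `Ω(C)`, and its integral over `Ω(C)` is `1`, for every `C`. -/
structure IsProbabilityForm {m : ℕ} (o : ∀ x : N, Orientation ℝ (TangentSpace I x) (Fin r))
    (φ : (Fin m → ℝ) → Euc n → Euc n) (ι : N → Euc n)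
    (ρ : (Fin m → ℝ) → Euc n → Euc n [⋀^Fin r]→L[ℝ] ℝ) : Prop where
  contDiffAt : ∀ C, ∀ x : N,
    ContDiffAt ℝ 1 (fun q : (Fin m → ℝ) × Euc n => ρ q.1 q.2) (C, φ C (ι x))
  nonneg : ∀ C, ∀ x : N, ∀ v : Fin r → TangentSpace I x, IsPosFrame (o x) v →
    0 ≤ pullbackAt I (φ C ∘ ι) (ρ C) x v
  integral_eq_one : ∀ C, formIntegral I o (φ C ∘ ι) (ρ C) = 1

/-- The expectation `⟨f⟩(C) = ∫_{Ω(C)} f ρ_C` of a function `f` on `Ω(C)`. -/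
noncomputable def expectation {m : ℕ} (o : ∀ x : N, Orientation ℝ (TangentSpace I x) (Fin r))
    (φ : (Fin m → ℝ) → Euc n → Euc n) (ι : N → Euc n)
    (ρ : (Fin m → ℝ) → Euc n → Euc n [⋀^Fin r]→L[ℝ] ℝ) (C : Fin m → ℝ) (f : Euc n → ℝ) : ℝ :=
  formIntegral I o (φ C ∘ ι) (fun s => f s • ρ C s)

/-- The `1`-form `⟨dβ⟩ = ∑_c ⟨∂β/∂C_c + ∇β · V_c⟩ dC_c` on the parameter space, at `C`. -/
noncomputable def expectationDiff {m : ℕ} (o : ∀ x : N, Orientation ℝ (TangentSpace I x) (Fin r))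
    (V : Fin m → Euc n → Euc n) (φ : (Fin m → ℝ) → Euc n → Euc n) (ι : N → Euc n)
    (ρ : (Fin m → ℝ) → Euc n → Euc n [⋀^Fin r]→L[ℝ] ℝ) (β : (Fin m → ℝ) → Euc n → ℝ)
    (C : Fin m → ℝ) : (Fin m → ℝ) →L[ℝ] ℝ :=
  ∑ c, expectation I o φ ι ρ C (totalDeriv V β C c) •
    (ContinuousLinearMap.proj c : (Fin m → ℝ) →L[ℝ] ℝ)

end Integration

/-!
The curve `h ↦ (φ^{h e_c})^* ρ_{C + h e_c}` is a composite of differentiable maps. Its derivative at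
`0` has a term from the argument of `ρ`, namely `∂ρ/∂C_c + D_{V_c} ρ`, and a term from the Jacobian of
the flow, which grows at the rate `D V_c` by the symmetry of mixed second derivatives
(`IsParamFlow.hasDerivAt_fderiv`). The pointwise identity
`interiorExtDeriv_add_extDerivInterior` rewrites the two spatial terms as
`i_{V_c} dρ + d (i_{V_c} ρ)`.

For the equivalence, the integral over `Ω(C)` is pulled back to the fixed manifold `N`. There the
integrand depends on `C` only through the function `pulledBackValue` of the parameter, the point
and the tangent vectors; it is `C¹`, and by the group law its derivative in `C_c` is the pullback of
the Lie derivative. Differentiating under the integral over compact sets of coordinates gives the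
transport theorem `hasFDerivAt_formIntegral`. Applied to `β ρ` and combined with the Leibniz rule
`L(β ρ) = (dβ) ρ + β L ρ`, it yields
`d⟨β⟩ = ⟨dβ⟩ + ∑_c (∫ β L^{(C_c)} ρ) dC_c` (`hasFDerivAt_expectation`).

Hence `d⟨β⟩ = ⟨dβ⟩` for all `β` exactly when every integral `∫ β L^{(C_c)} ρ` vanishes. Bump
functions that do not depend on the parameter suffice to conclude that the continuous top-degree
form `L^{(C_c)} ρ` is zero on `Ω(C)`
(`pullbackAt_eq_zero_of_formIntegral_smul_eq_zero`): near a point where it does not vanish, its sign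
on a frame relative to the orientation of that frame is the same in all charts
(`frameSign_mul_pos`), so the local contributions to the integral cannot cancel.
-/

/-! ### Cartan's formula -/

section Cartan

variable {n r : ℕ}

/-- The part of Cartan's formula that does not involve the flow:
`i_U dη + d (i_U η)` at `s` is `D_U η + ∑ᵢ η(…, DU(vᵢ), …)`. -/
lemma interiorExtDeriv_add_extDerivInterior {U : Euc n → Euc n}
    {η : Euc n → Euc n [⋀^Fin r]→L[ℝ] ℝ} {s : Euc n}
    (hη : DifferentiableAt ℝ η s) (hU : DifferentiableAt ℝ U s) :
    interiorExtDeriv U η s + extDerivInterior U η s =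
      fderiv ℝ η s (U s) +
        (η s).fderivCompContinuousLinearMap (ContinuousLinearMap.id ℝ (Euc n)) (fderiv ℝ U s) := by
  cases r with
  | zero =>
    ext v
    simp [interiorExtDeriv, extDerivInterior, extDeriv,
      ContinuousAlternatingMap.alternatizeUncurryFin_apply,
      ContinuousAlternatingMap.fderivCompContinuousLinearMap_of_isEmpty]
  | succ r =>
    have hcurry : HasFDerivAt (fun x => (η x).curryLeft (U x)) _ s :=
      (ContinuousAlternatingMap.curryLeftLI (𝕜 := ℝ) (E := Euc n) (F := ℝ)
        (n := r)).toContinuousLinearMap.hasFDerivAt_of_bilinear hη.hasFDerivAt hU.hasFDerivAt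
    ext v
    simp only [interiorExtDeriv, extDerivInterior, extDeriv, hcurry.fderiv,
      ContinuousAlternatingMap.fderivCompContinuousLinearMap_eq_alternatizeUncurryFin]
    have hremove : ∀ i : Fin (r + 1), i.succ.removeNth (Matrix.vecCons (U s) v) =
        Matrix.vecCons (U s) (i.removeNth v) := by
      intro i
      ext1 k
      cases k using Fin.cases <;> simp [Fin.removeNth]
    have hzero : (0 : Fin (r + 2)).removeNth (Matrix.vecCons (U s) v) = v := by
      ext1 k
      simp [Fin.removeNth]
    simp only [ContinuousAlternatingMap.add_apply,
      ContinuousAlternatingMap.curryLeft_apply_apply,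
      ContinuousAlternatingMap.alternatizeUncurryFin_apply]
    -- the term of `dη(U, v)` that omits `U` is `D_U η`; the others cancel the terms of
    -- `d (i_U η)` in which `η` is differentiated
    rw [Fin.sum_univ_succ]
    simp only [hremove, hzero, Matrix.cons_val_zero, Matrix.cons_val_succ, Fin.val_succ, pow_succ]
    simp [ContinuousAlternatingMap.alternatizeUncurryFin_apply, Finset.sum_add_distrib]
    ring

end Cartan

/-! ### First derivatives of the flow -/

section Flow

variable {n m r : ℕ} {M : Set (Euc n)} {V : Fin m → Euc n → Euc n}
  {φ : (Fin m → ℝ) → Euc n → Euc n}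

lemma IsParamFlow.contDiffAt (hφ : IsParamFlow M V φ) (hM : IsOpen M) (C : Fin m → ℝ) {s : Euc n}
    (hs : s ∈ M) : ContDiffAt ℝ ∞ (fun q : (Fin m → ℝ) × Euc n => φ q.1 q.2) (C, s) :=
  hφ.smooth_flow.contDiffAt ((isOpen_univ.prod hM).mem_nhds ⟨trivial, hs⟩)

lemma IsParamFlow.contDiffAt_apply (hφ : IsParamFlow M V φ) (hM : IsOpen M) (C : Fin m → ℝ)
    {s : Euc n} (hs : s ∈ M) : ContDiffAt ℝ ∞ (φ C) s :=
  (hφ.contDiffAt hM C hs).comp s (f := fun s => (C, s)) (by fun_prop)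

lemma IsParamFlow.differentiableAt (hφ : IsParamFlow M V φ) (hM : IsOpen M) (C : Fin m → ℝ)
    {s : Euc n} (hs : s ∈ M) : DifferentiableAt ℝ (φ C) s :=
  (hφ.contDiffAt_apply hM C hs).differentiableAt (by simp)

lemma IsParamFlow.contDiffAt_fderiv (hφ : IsParamFlow M V φ) (hM : IsOpen M) (C : Fin m → ℝ)
    {s : Euc n} (hs : s ∈ M) :
    ContDiffAt ℝ 1 (fun q : (Fin m → ℝ) × Euc n => fderiv ℝ (φ q.1) q.2) (C, s) := by
  refine ContDiffAt.fderiv (n := 2)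
    (f := fun (q : (Fin m → ℝ) × Euc n) => φ q.1) (g := Prod.snd) ?_ (by fun_prop) (by norm_num)
  exact ((hφ.contDiffAt hM C hs).of_le (m := 2) ENat.LEInfty.out).comp
    (((C, s), s) : ((Fin m → ℝ) × Euc n) × Euc n)
    (f := fun q : ((Fin m → ℝ) × Euc n) × Euc n => (q.1.1, q.2)) (by fun_prop)

/-- The Jacobian of the flow is the composite of Jacobians along `φ^{B+C} = φ^B ∘ φ^C`. -/
lemma IsParamFlow.fderiv_add (hφ : IsParamFlow M V φ) (hM : IsOpen M) (B C : Fin m → ℝ)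
    {s : Euc n} (hs : s ∈ M) :
    fderiv ℝ (φ (B + C)) s = (fderiv ℝ (φ B) (φ C s)).comp (fderiv ℝ (φ C) s) := by
  rw [← fderiv_comp s (hφ.differentiableAt hM B (hφ.mapsTo C hs)) (hφ.differentiableAt hM C hs)]
  refine Filter.EventuallyEq.fderiv_eq ?_
  filter_upwards [hM.mem_nhds hs] with t ht
  exact (hφ.add B C t ht).symm

lemma IsParamFlow.fderiv_zero (hφ : IsParamFlow M V φ) (hM : IsOpen M) {s : Euc n} (hs : s ∈ M) :
    fderiv ℝ (φ 0) s = ContinuousLinearMap.id ℝ (Euc n) := by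
  rw [← fderiv_id (x := s)]
  refine Filter.EventuallyEq.fderiv_eq ?_
  filter_upwards [hM.mem_nhds hs] with t ht
  exact hφ.zero t ht

lemma hasDerivAt_add_single (C : Fin m → ℝ) (c : Fin m) :
    HasDerivAt (fun h : ℝ => C + Pi.single c h) (Pi.single c 1) 0 :=
  (_root_.hasDerivAt_single c (0 : ℝ)).const_add C

lemma hasDerivAt_add_single_prodMk {F : Type*} [NormedAddCommGroup F] [NormedSpace ℝ F]
    (C : Fin m → ℝ) (c : Fin m) (e : F) :
    HasDerivAt (fun h : ℝ => (C + Pi.single c h, e)) (Pi.single c 1, 0) 0 :=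
  (hasDerivAt_add_single C c).prodMk (hasDerivAt_const _ _)

lemma IsParamFlow.hasDerivAt_zero (hφ : IsParamFlow M V φ) (c : Fin m) {s : Euc n} (hs : s ∈ M) :
    HasDerivAt (fun h : ℝ => φ (Pi.single c h) s) (V c s) 0 := by
  simpa [hφ.zero s hs] using hφ.deriv 0 c s hs

lemma IsParamFlow.injOn (hφ : IsParamFlow M V φ) (C : Fin m → ℝ) : InjOn (φ C) M := by
  intro s hs t ht hst
  rw [← hφ.zero s hs, ← hφ.zero t ht, ← neg_add_cancel C, ← hφ.add _ _ s hs, hst, hφ.add _ _ t ht]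

/-- The Jacobian of the flow grows at the rate of the Jacobian of the field: this is the symmetry of
the mixed second derivatives of `(C, s) ↦ φ C s`. -/
lemma IsParamFlow.hasDerivAt_fderiv (hφ : IsParamFlow M V φ) (hM : IsOpen M) (c : Fin m)
    {s : Euc n} (hs : s ∈ M) :
    HasDerivAt (fun h : ℝ => fderiv ℝ (φ (Pi.single c h)) s) (fderiv ℝ (V c) s) 0 := by
  set F : (Fin m → ℝ) × Euc n → Euc n := fun q => φ q.1 q.2 with hF
  have hFs : ContDiffAt ℝ ∞ F (0, s) := hφ.contDiffAt hM 0 hs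
  have hF2 : HasFDerivAt (fderiv ℝ F) (fderiv ℝ (fderiv ℝ F) (0, s)) (0, s) :=
    ((hFs.fderiv_right (m := 1) (one_add_one_eq_two (R := ℕ∞ω) ▸ ENat.LEInfty.out)
      ).differentiableAt (by simp)).hasFDerivAt
  have hsymm : IsSymmSndFDerivAt ℝ F (0, s) :=
    hFs.isSymmSndFDerivAt (by simpa using ENat.LEInfty.out)
  have hdiff : ∀ B : Fin m → ℝ, ∀ t ∈ M, HasFDerivAt F (fderiv ℝ F (B, t)) (B, t) := fun B t ht =>
    ((hφ.contDiffAt hM B ht).differentiableAt (by simp)).hasFDerivAt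
  -- the two partial derivatives of `F`
  have hsnd : ∀ B : Fin m → ℝ, ∀ t ∈ M,
      fderiv ℝ (φ B) t = (fderiv ℝ F (B, t)).comp (ContinuousLinearMap.inr ℝ _ _) := by
    intro B t ht
    exact ((hdiff B t ht).comp t (hasFDerivAt_prodMk_right B t)).fderiv
  have hfst : ∀ t ∈ M, fderiv ℝ F (0, t) (Pi.single c 1, 0) = V c t := by
    intro t ht
    have h2 := (hdiff 0 t ht).comp_hasDerivAt_of_eq (0 : ℝ)
      (hasDerivAt_add_single_prodMk 0 c t) (by simp)
    have h3 := hφ.deriv 0 c t ht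
    rw [hφ.zero t ht] at h3
    exact h2.unique h3
  have h2 := hF2.comp_hasDerivAt_of_eq (0 : ℝ) (hasDerivAt_add_single_prodMk 0 c s) (by simp)
  have h3 := h2.clm_comp (hasDerivAt_const (0 : ℝ) (ContinuousLinearMap.inr ℝ (Fin m → ℝ) (Euc n)))
  refine (h3.congr_deriv ?_).congr_of_eventuallyEq (.of_forall fun h => ?_)
  · ext1 w
    -- the field is `∂F/∂C_c` at parameter `0`, so its Jacobian is the mixed derivative in the
    -- other order
    have h4 : HasFDerivAt (fun t => fderiv ℝ F (0, t) (Pi.single c 1, 0)) _ s :=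
      (hF2.comp s (hasFDerivAt_prodMk_right (0 : Fin m → ℝ) s)).clm_apply
        (hasFDerivAt_const (Pi.single c 1, 0) s)
    have h5 : fderiv ℝ (V c) s = _ := (h4.congr_of_eventuallyEq (f₁ := V c) (by
      filter_upwards [hM.mem_nhds hs] with t ht using (hfst t ht).symm)).fderiv
    rw [h5]
    simpa using hsymm (Pi.single c 1, 0) (0, w)
  · simpa using hsnd (Pi.single c h) s hs

end Flow

/-! ### The multiparameter Lie derivative -/

section LieDerivative

variable {n m r : ℕ} {M : Set (Euc n)} {V : Fin m → Euc n → Euc n}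
  {φ : (Fin m → ℝ) → Euc n → Euc n} {ρ : (Fin m → ℝ) → Euc n → Euc n [⋀^Fin r]→L[ℝ] ℝ}
  {C : Fin m → ℝ} {s : Euc n}

/-- Along a flow line, a function of the parameter and the point changes at the rate given by its
total derivative. -/
lemma IsParamFlow.hasDerivAt_comp {F : Type*} [NormedAddCommGroup F] [NormedSpace ℝ F]
    (hφ : IsParamFlow M V φ) (hs : s ∈ M) (c : Fin m)
    {f : (Fin m → ℝ) → Euc n → F}
    (hf : DifferentiableAt ℝ (fun q : (Fin m → ℝ) × Euc n => f q.1 q.2) (C, s)) :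
    HasDerivAt (fun h : ℝ => f (C + Pi.single c h) (φ (Pi.single c h) s))
      (fderiv ℝ (fun q : (Fin m → ℝ) × Euc n => f q.1 q.2) (C, s) (Pi.single c 1, V c s)) 0 := by
  refine hf.hasFDerivAt.comp_hasDerivAt_of_eq (0 : ℝ)
    ((hasDerivAt_add_single C c).prodMk (hφ.hasDerivAt_zero c hs)) ?_
  simp [hφ.zero s hs]

lemma IsParamFlow.hasDerivAt_pullbackCurve (hφ : IsParamFlow M V φ) (hM : IsOpen M) (hs : s ∈ M)
    (hρ : DifferentiableAt ℝ (fun q : (Fin m → ℝ) × Euc n => ρ q.1 q.2) (C, s)) (c : Fin m) :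
    HasDerivAt (pullbackCurve φ ρ C c s)
      (fderiv ℝ (fun q : (Fin m → ℝ) × Euc n => ρ q.1 q.2) (C, s) (Pi.single c 1, V c s) +
        (ρ C s).fderivCompContinuousLinearMap (ContinuousLinearMap.id ℝ (Euc n))
          (fderiv ℝ (V c) s)) 0 := by
  have h := ((hφ.hasDerivAt_comp hs c hρ).hasFDerivAt
    |>.continuousAlternatingMapCompContinuousLinearMap
      (hφ.hasDerivAt_fderiv hM c hs).hasFDerivAt).hasDerivAt
  refine h.congr_deriv ?_
  ext v
  simp [hφ.zero s hs, hφ.fderiv_zero hM hs]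

lemma IsParamFlow.hasDerivAt_pullbackCurve_lieDeriv (hφ : IsParamFlow M V φ) (hM : IsOpen M)
    (hs : s ∈ M)
    (hρ : DifferentiableAt ℝ (fun q : (Fin m → ℝ) × Euc n => ρ q.1 q.2) (C, s)) (c : Fin m) :
    HasDerivAt (pullbackCurve φ ρ C c s) (lieDeriv φ ρ C c s) 0 :=
  (hφ.hasDerivAt_pullbackCurve hM hs hρ c).differentiableAt.hasDerivAt

/-- Cartan's formula for the multiparameter Lie derivative. -/
lemma IsParamFlow.lieDeriv_eq (hφ : IsParamFlow M V φ) (hM : IsOpen M) (hs : s ∈ M)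
    (hρ : DifferentiableAt ℝ (fun q : (Fin m → ℝ) × Euc n => ρ q.1 q.2) (C, s)) (c : Fin m) :
    lieDeriv φ ρ C c s =
      paramDeriv ρ C c s + interiorExtDeriv (V c) (ρ C) s + extDerivInterior (V c) (ρ C) s := by
  have hsnd : HasFDerivAt (ρ C) _ s := hρ.hasFDerivAt.comp s (hasFDerivAt_prodMk_right C s)
  have hfst : HasDerivAt (fun h : ℝ => ρ (C + Pi.single c h) s) _ 0 :=
    hρ.hasFDerivAt.comp_hasDerivAt_of_eq (0 : ℝ) (hasDerivAt_add_single_prodMk C c s) (by simp)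
  have hV : DifferentiableAt ℝ (V c) s :=
    ((hφ.smooth_field c).contDiffAt (hM.mem_nhds hs)).differentiableAt (by simp)
  rw [add_assoc, interiorExtDeriv_add_extDerivInterior hsnd.differentiableAt hV, ← add_assoc,
    lieDeriv, (hφ.hasDerivAt_pullbackCurve hM hs hρ c).deriv, paramDeriv, hfst.deriv, hsnd.fderiv]
  congr 1
  rw [ContinuousLinearMap.comp_apply, ← map_add]
  simp

/-- The Leibniz rule for the product of a function and a form. -/
lemma IsParamFlow.lieDeriv_smul (hφ : IsParamFlow M V φ) (hM : IsOpen M) (hs : s ∈ M)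
    (hρ : DifferentiableAt ℝ (fun q : (Fin m → ℝ) × Euc n => ρ q.1 q.2) (C, s))
    {β : (Fin m → ℝ) → Euc n → ℝ}
    (hβ : DifferentiableAt ℝ (fun q : (Fin m → ℝ) × Euc n => β q.1 q.2) (C, s)) (c : Fin m) :
    lieDeriv φ (fun C s => β C s • ρ C s) C c s =
      totalDeriv V β C c s • ρ C s + β C s • lieDeriv φ ρ C c s := by
  have h := (hφ.hasDerivAt_comp hs c hβ).smul (hφ.hasDerivAt_pullbackCurve_lieDeriv hM hs hρ c)
  have h0 : pullbackCurve φ ρ C c s 0 = ρ C s := by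
    ext v
    simp [pullbackCurve, hφ.zero s hs, hφ.fderiv_zero hM hs]
  refine (HasDerivAt.deriv (f := pullbackCurve φ (fun C s => β C s • ρ C s) C c s)
    (h.congr_of_eventuallyEq (.of_forall fun h => ?_))).trans ?_
  · ext v
    simp [pullbackCurve]
  · simp [h0, hφ.zero s hs, totalDeriv, add_comm]

lemma contDiff_alternating_apply {E : Type*} [NormedAddCommGroup E] [NormedSpace ℝ E] {k : ℕ∞ω} :
    ContDiff ℝ k (fun p : (E [⋀^Fin r]→L[ℝ] ℝ) × (Fin r → E) => p.1 p.2) :=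
  (((ContinuousAlternatingMap.toContinuousMultilinearMapCLM (𝕜 := ℝ) (E := E) (F := ℝ)
    (ι := Fin r) ℝ).flipMultilinear.contDiff.comp
    contDiff_snd).clm_apply contDiff_fst)

/-- The value of `(φ^C)^* ρ_C` at `s` on the vectors `w`, as a function of `(C, s, w)`. -/
noncomputable def pulledBackValue (φ : (Fin m → ℝ) → Euc n → Euc n)
    (ρ : (Fin m → ℝ) → Euc n → Euc n [⋀^Fin r]→L[ℝ] ℝ)
    (p : (Fin m → ℝ) × Euc n × (Fin r → Euc n)) : ℝ :=
  ρ p.1 (φ p.1 p.2.1) (fun k => fderiv ℝ (φ p.1) p.2.1 (p.2.2 k))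

lemma IsParamFlow.contDiffAt_pulledBackValue (hφ : IsParamFlow M V φ) (hM : IsOpen M)
    (hs : s ∈ M) (w : Fin r → Euc n)
    (hρ : ContDiffAt ℝ 1 (fun q : (Fin m → ℝ) × Euc n => ρ q.1 q.2) (C, φ C s)) :
    ContDiffAt ℝ 1 (pulledBackValue φ ρ) (C, s, w) := by
  have hproj : ContDiffAt ℝ 1
      (fun p : (Fin m → ℝ) × Euc n × (Fin r → Euc n) => (p.1, p.2.1)) (C, s, w) := by fun_prop
  refine contDiff_alternating_apply.contDiffAt.comp (C, s, w)
    (f := fun p : (Fin m → ℝ) × Euc n × (Fin r → Euc n) =>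
      (ρ p.1 (φ p.1 p.2.1), fun k => fderiv ℝ (φ p.1) p.2.1 (p.2.2 k))) (.prodMk ?_ ?_)
  · refine hρ.comp (C, s, w) (f := fun p : (Fin m → ℝ) × Euc n × (Fin r → Euc n) =>
      (p.1, φ p.1 p.2.1)) (.prodMk (by fun_prop) ?_)
    exact ((hφ.contDiffAt hM C hs).of_le (m := 1) ENat.LEInfty.out).comp (C, s, w) hproj
  · refine contDiffAt_pi.2 fun k => ContDiffAt.clm_apply ?_ (by fun_prop)
    exact (hφ.contDiffAt_fderiv hM C hs).comp (C, s, w) hproj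

/-- The partial derivative of `(φ^C)^* ρ_C` in the parameter is `(φ^C)^*` of the Lie derivative. -/
lemma IsParamFlow.fderiv_pulledBackValue (hφ : IsParamFlow M V φ) (hM : IsOpen M)
    (hs : s ∈ M) (w : Fin r → Euc n)
    (hρ : ContDiffAt ℝ 1 (fun q : (Fin m → ℝ) × Euc n => ρ q.1 q.2) (C, φ C s)) (c : Fin m) :
    fderiv ℝ (pulledBackValue φ ρ) (C, s, w) (Pi.single c 1, 0) =
      lieDeriv φ ρ C c (φ C s) (fun k => fderiv ℝ (φ C) s (w k)) := by
  have h1 : HasDerivAt (fun h : ℝ => pulledBackValue φ ρ (C + Pi.single c h, s, w)) _ 0 :=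
    ((hφ.contDiffAt_pulledBackValue hM hs w hρ).differentiableAt
      (by simp)).hasFDerivAt.comp_hasDerivAt_of_eq (0 : ℝ)
      (hasDerivAt_add_single_prodMk C c (s, w)) (by simp)
  have h2 := ((ContinuousAlternatingMap.apply ℝ (Euc n) ℝ
    (fun k => fderiv ℝ (φ C) s (w k))).hasFDerivAt.comp_hasDerivAt (0 : ℝ)
    (hφ.hasDerivAt_pullbackCurve_lieDeriv hM (hφ.mapsTo C hs) (hρ.differentiableAt (by simp)) c))
  refine h1.unique (h2.congr_of_eventuallyEq (.of_forall fun h => ?_))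
  simp [pulledBackValue, pullbackCurve, add_comm C, hφ.fderiv_add hM _ C hs, hφ.add _ C s hs,
    Function.comp_def]

end LieDerivative

/-! ### Differentiation under the integral over a compact set -/

lemma continuousOn_fderiv_parameter {P Y Z : Type*} [NormedAddCommGroup P] [NormedSpace ℝ P]
    [NormedAddCommGroup Z] [NormedSpace ℝ Z] [TopologicalSpace Y]
    {K : Set Y} {z : Y → Z} {g : P × Z → ℝ} (hz : ContinuousOn z K)
    (hg : ∀ C, ∀ y ∈ K, ContDiffAt ℝ 1 g (C, z y)) :
    ContinuousOn (fun p : P × Y => fderiv ℝ g (p.1, z p.2)) (univ ×ˢ K) := by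
  rintro ⟨C, y⟩ ⟨-, hy⟩
  have hzy : ContinuousWithinAt (fun p : P × Y => (p.1, z p.2)) (univ ×ˢ K) (C, y) :=
    continuousWithinAt_fst.prodMk
      (ContinuousWithinAt.comp (g := z) (hz y hy) continuousWithinAt_snd fun p hp => hp.2)
  exact ContinuousAt.comp_continuousWithinAt (g := fderiv ℝ g) (f := fun p : P × Y => (p.1, z p.2))
    ((hg C y hy).fderiv_right (m := 0) (by simp)).continuousAt hzy

/-- The first component is the integrability of the derivative, which makes the integral in the
second one meaningful. -/
lemma hasFDerivAt_setIntegral_of_contDiffAt {P Y Z : Type*} [NormedAddCommGroup P]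
    [NormedSpace ℝ P] [ProperSpace P] [NormedAddCommGroup Z] [NormedSpace ℝ Z] [TopologicalSpace Y]
    [T2Space Y] [MeasurableSpace Y] [OpensMeasurableSpace Y] {μ : Measure Y}
    [IsFiniteMeasureOnCompacts μ] {K : Set Y} (hK : IsCompact K) {a : Y → ℝ} {z : Y → Z}
    {g : P × Z → ℝ} (ha : ContinuousOn a K) (hz : ContinuousOn z K)
    (hg : ∀ C, ∀ y ∈ K, ContDiffAt ℝ 1 g (C, z y)) (C : P) :
    IntegrableOn (fun y => a y • (fderiv ℝ g (C, z y)).comp (ContinuousLinearMap.inl ℝ P Z)) K μ ∧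
    HasFDerivAt (fun C => ∫ y in K, a y * g (C, z y) ∂μ)
      (∫ y in K, a y • (fderiv ℝ g (C, z y)).comp (ContinuousLinearMap.inl ℝ P Z) ∂μ) C := by
  have hG : ∀ C, ContinuousOn (fun y => a y * g (C, z y)) K := fun C =>
    ha.mul fun y hy => ContinuousAt.comp_continuousWithinAt (g := g) (f := fun y => (C, z y))
      (hg C y hy).continuousAt (continuousWithinAt_const.prodMk (hz y hy))
  have hG' : ContinuousOn (fun p : P × Y => a p.2 •
      (fderiv ℝ g (p.1, z p.2)).comp (ContinuousLinearMap.inl ℝ P Z)) (univ ×ˢ K) :=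
    (ha.comp continuousOn_snd fun p hp => hp.2).smul
      ((continuousOn_fderiv_parameter hz hg).clm_comp continuousOn_const)
  have hG'C : ContinuousOn (fun y => a y •
      (fderiv ℝ g (C, z y)).comp (ContinuousLinearMap.inl ℝ P Z)) K :=
    ContinuousOn.comp (g := fun p : P × Y => a p.2 •
      (fderiv ℝ g (p.1, z p.2)).comp (ContinuousLinearMap.inl ℝ P Z)) (f := fun y => (C, y)) hG'
      (by fun_prop) fun y hy => ⟨trivial, hy⟩
  obtain ⟨B, hB⟩ := ((isCompact_closedBall C 1).prod hK).exists_bound_of_continuousOn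
    (hG'.mono (prod_mono_left (subset_univ _)))
  refine ⟨hG'C.integrableOn_compact hK, ?_⟩
  refine hasFDerivAt_integral_of_dominated_of_fderiv_le (bound := fun _ => B)
    (F' := fun C y => a y • (fderiv ℝ g (C, z y)).comp (ContinuousLinearMap.inl ℝ P Z))
    (Metric.ball_mem_nhds C one_pos)
    (.of_forall fun C => (hG C).aestronglyMeasurable_of_isCompact hK hK.measurableSet)
    ((hG C).integrableOn_compact hK)
    (hG'C.aestronglyMeasurable_of_isCompact hK hK.measurableSet)
    ((ae_restrict_iff' hK.measurableSet).2 (.of_forall fun y hy C' hC' =>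
      hB (C', y) ⟨Metric.ball_subset_closedBall hC', hy⟩))
    (integrableOn_const hK.measure_lt_top.ne)
    ((ae_restrict_iff' hK.measurableSet).2 (.of_forall fun y hy C' _ => ?_))
  exact (((hg C' y hy).differentiableAt (by simp)).hasFDerivAt.comp C'
    (hasFDerivAt_prodMk_left C' (z y))).const_mul (a y)

/-! ### Signs of frames -/

section Frames

variable {T : Type*} [AddCommGroup T] [Module ℝ T] {r : ℕ} (o : Orientation ℝ T (Fin r))

lemma isPosFrame_basis_iff (b : Module.Basis (Fin r) ℝ T) :
    IsPosFrame o b ↔ b.orientation = o := by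
  constructor
  · rintro ⟨b', hb', rfl⟩
    rw [DFunLike.coe_injective hb']
  · exact fun h => ⟨b, rfl, h⟩

variable {o} in
lemma frameSign_of_isPosFrame {v : Fin r → T} (h : IsPosFrame o v) : frameSign o v = 1 :=
  if_pos h

variable {o} in
lemma frameSign_of_not_isPosFrame {v : Fin r → T} (h : ¬ IsPosFrame o v) : frameSign o v = -1 :=
  if_neg h

/-- Whether a top-degree form agrees in sign with the orientation can be tested on any basis. -/
lemma frameSign_mul_pos (b b' : Module.Basis (Fin r) ℝ T) (l : T [⋀^Fin r]→ₗ[ℝ] ℝ)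
    (h : 0 < frameSign o b * l b) : 0 < frameSign o b' * l b' := by
  have hl : l b' = l b * b.det b' := by
    conv_lhs => rw [l.eq_smul_basis_det b]
    simp
  have hdet : b.det b' ≠ 0 := (b.isUnit_det b').ne_zero
  have hpos := b.orientation_eq_iff_det_pos b'
  have hneg := b.orientation_ne_iff_eq_neg o
  have hneg' := b'.orientation_ne_iff_eq_neg o
  rw [hl]
  by_cases h1 : b.orientation = o <;> by_cases h2 : b'.orientation = o
  · have := hpos.1 (h1.trans h2.symm)
    rw [frameSign_of_isPosFrame ((isPosFrame_basis_iff o b).2 h1)] at h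
    rw [frameSign_of_isPosFrame ((isPosFrame_basis_iff o b').2 h2), ← mul_assoc]
    exact mul_pos h this
  · have : b.det b' < 0 := lt_of_le_of_ne
      (not_lt.1 fun hlt => h2 ((hpos.2 hlt).symm.trans h1)) hdet
    rw [frameSign_of_isPosFrame ((isPosFrame_basis_iff o b).2 h1)] at h
    rw [frameSign_of_not_isPosFrame (h2 ∘ (isPosFrame_basis_iff o b').1)]
    nlinarith
  · have : b.det b' < 0 := lt_of_le_of_ne
      (not_lt.1 fun hlt => h1 ((hpos.2 hlt).trans h2)) hdet
    rw [frameSign_of_not_isPosFrame (h1 ∘ (isPosFrame_basis_iff o b).1)] at h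
    rw [frameSign_of_isPosFrame ((isPosFrame_basis_iff o b').2 h2)]
    nlinarith
  · have := hpos.1 (neg_injective ((hneg.1 (Ne.symm h1)).symm.trans (hneg'.1 (Ne.symm h2))))
    rw [frameSign_of_not_isPosFrame (h1 ∘ (isPosFrame_basis_iff o b).1)] at h
    rw [frameSign_of_not_isPosFrame (h2 ∘ (isPosFrame_basis_iff o b').1), ← mul_assoc]
    exact mul_pos h this

lemma frameSign_ne_zero (v : Fin r → T) : frameSign o v ≠ 0 := by
  unfold frameSign
  split_ifs <;> simp

end Frames

/-! ### The integral of a form in charts -/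

section Charts

variable {n r : ℕ} {H : Type*} [TopologicalSpace H] (I : ModelWithCorners ℝ (Euc r) H)
  {N : Type*} [TopologicalSpace N] [ChartedSpace H N]

/-- The coefficient of `j^* η` in the chart of `N` around `i`, as a function of the
coordinates. -/
noncomputable def chartCoeff (j : N → Euc n) (η : Euc n → Euc n [⋀^Fin r]→L[ℝ] ℝ) (i : N)
    (y : Euc r) : ℝ :=
  pullbackAt I j η ((extChartAt I i).symm y) (chartFrame I i ((extChartAt I i).symm y))

lemma pullbackAt_smul (j : N → Euc n) (f : Euc n → ℝ) (η : Euc n → Euc n [⋀^Fin r]→L[ℝ] ℝ)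
    (x : N) : pullbackAt I j (fun s => f s • η s) x = f (j x) • pullbackAt I j η x :=
  rfl

lemma measurableSet_extChartAt_target (i : N) : MeasurableSet (extChartAt I i).target := by
  rw [extChartAt_target]
  exact (((chartAt H i).open_target.preimage I.continuous_symm).measurableSet).inter
    I.isClosed_range.measurableSet

lemma continuousOn_frameSign {o : ∀ x : N, Orientation ℝ (TangentSpace I x) (Fin r)}
    (ho : IsContinuousOrientation I o) (i : N) :
    ContinuousOn (fun x => frameSign (o x) (chartFrame I i x)) (chartAt H i).source := by
  intro x hx
  refine ContinuousAt.continuousWithinAt (continuousAt_const.congr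
    (f := fun _ => frameSign (o x) (chartFrame I i x)) ?_)
  filter_upwards [ho i x hx] with y hy
  by_cases hpos : IsPosFrame (o x) (chartFrame I i x)
  · rw [frameSign_of_isPosFrame hpos, frameSign_of_isPosFrame (hy.2 hpos)]
  · rw [frameSign_of_not_isPosFrame hpos, frameSign_of_not_isPosFrame (hpos ∘ hy.1)]

lemma mapsTo_extChartAt_symm (i : N) :
    MapsTo (extChartAt I i).symm (extChartAt I i).target (chartAt H i).source := fun y hy => by
  simpa [extChartAt_source] using (extChartAt I i).map_target hy

variable [IsManifold I ∞ N]

lemma exists_basis_chartFrame {i x : N} (hx : x ∈ (chartAt H i).source) :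
    ∃ b : Module.Basis (Fin r) ℝ (TangentSpace I x), ⇑b = chartFrame I i x := by
  have hy : extChartAt I i x ∈ (extChartAt I i).target :=
    (extChartAt I i).map_source (by rwa [extChartAt_source])
  have : IsManifold I 1 N := IsManifold.of_le (n := ∞) ENat.LEInfty.out
  obtain ⟨e, he⟩ := isInvertible_mfderivWithin_extChartAt_symm (I := I) hy
  let e' : Euc r ≃ₗ[ℝ] TangentSpace I x := e.toLinearEquiv
  refine ⟨(EuclideanSpace.basisFun (Fin r) ℝ).toBasis.map e', ?_⟩
  ext1 k
  rw [chartFrame, ← he, Module.Basis.map_apply, OrthonormalBasis.coe_toBasis,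
    EuclideanSpace.basisFun_apply]
  rfl

variable [T2Space N] [CompactSpace N]

/-- The weight of the chart around `i` in the integral of a form: the partition function times the
sign of the coordinate frame. -/
noncomputable def chartWeight (o : ∀ x : N, Orientation ℝ (TangentSpace I x) (Fin r)) (i : N)
    (y : Euc r) : ℝ :=
  chartPartition I N i ((extChartAt I i).symm y) *
    frameSign (o ((extChartAt I i).symm y)) (chartFrame I i ((extChartAt I i).symm y))

/-- The coordinates of the support of the partition function of the chart around `i`. -/
noncomputable def chartSupport (i : N) : Set (Euc r) :=
  extChartAt I i '' tsupport (chartPartition I N i)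

lemma tsupport_chartPartition_subset (i : N) :
    tsupport (chartPartition I N i) ⊆ (chartAt H i).source :=
  (SmoothPartitionOfUnity.exists_isSubordinate_chartAt_source (I := I) N).choose_spec i

lemma chartSupport_subset_target (i : N) : chartSupport I i ⊆ (extChartAt I i).target := by
  rintro _ ⟨x, hx, rfl⟩
  exact (extChartAt I i).map_source (by
    simpa [extChartAt_source] using tsupport_chartPartition_subset I i hx)

lemma isCompact_chartSupport (i : N) : IsCompact (chartSupport I i) := by
  refine (isClosed_tsupport _).isCompact.image_of_continuousOn
    ((continuousOn_extChartAt i).mono ?_)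
  simpa [extChartAt_source] using tsupport_chartPartition_subset I i

lemma mem_chartSupport {i : N} {y : Euc r} (hy : y ∈ (extChartAt I i).target)
    (h : chartPartition I N i ((extChartAt I i).symm y) ≠ 0) : y ∈ chartSupport I i :=
  ⟨_, subset_tsupport _ h, (extChartAt I i).right_inv hy⟩

lemma continuousOn_chartWeight {o : ∀ x : N, Orientation ℝ (TangentSpace I x) (Fin r)}
    (ho : IsContinuousOrientation I o) (i : N) :
    ContinuousOn (chartWeight I o i) (extChartAt I i).target :=
  ((chartPartition I N i).contMDiff.continuous.comp_continuousOn (continuousOn_extChartAt_symm i)).mul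
    ((continuousOn_frameSign I ho i).comp (continuousOn_extChartAt_symm i)
      (mapsTo_extChartAt_symm I i))

variable (N) in
/-- The finitely many charts whose partition function does not vanish identically. -/
noncomputable def activeCharts : Finset N :=
  ((chartPartition I N).locallyFinite.finite_nonempty_of_compact).toFinset

/-- The integral of a form is a finite sum of integrals over compact sets of coordinates. -/
lemma formIntegral_eq_sum (o : ∀ x : N, Orientation ℝ (TangentSpace I x) (Fin r))
    (j : N → Euc n) (η : Euc n → Euc n [⋀^Fin r]→L[ℝ] ℝ) :
    formIntegral I o j η = ∑ i ∈ activeCharts I N,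
      ∫ y in chartSupport I i, chartWeight I o i y * chartCoeff I j η i y := by
  have hterm : ∀ i : N, (∫ y in (extChartAt I i).target,
      chartPartition I N i ((extChartAt I i).symm y) *
        frameSign (o ((extChartAt I i).symm y)) (chartFrame I i ((extChartAt I i).symm y)) *
        pullbackAt I j η ((extChartAt I i).symm y) (chartFrame I i ((extChartAt I i).symm y))) =
      ∫ y in chartSupport I i, chartWeight I o i y * chartCoeff I j η i y := fun i => by
    refine setIntegral_eq_of_subset_of_forall_sdiff_eq_zero (measurableSet_extChartAt_target I i)
      (chartSupport_subset_target I i) fun y hy => ?_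
    have : chartPartition I N i ((extChartAt I i).symm y) = 0 := by
      by_contra h
      exact hy.2 (mem_chartSupport I hy.1 h)
    rw [this, zero_mul, zero_mul]
  unfold formIntegral
  refine (finsum_congr hterm).trans (finsum_eq_sum_of_support_subset _ fun i hi => ?_)
  by_contra h
  refine hi ?_
  have h0 : ∀ x, chartPartition I N i x = 0 := by
    simpa [activeCharts, Set.Nonempty] using h
  simp [chartWeight, h0]

lemma integrableOn_chartWeight_mul {o : ∀ x : N, Orientation ℝ (TangentSpace I x) (Fin r)}
    (ho : IsContinuousOrientation I o) {j : N → Euc n} {η : Euc n → Euc n [⋀^Fin r]→L[ℝ] ℝ} {i : N}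
    (hη : ContinuousOn (chartCoeff I j η i) (extChartAt I i).target) :
    IntegrableOn (fun y => chartWeight I o i y * chartCoeff I j η i y) (chartSupport I i) :=
  (((continuousOn_chartWeight I ho i).mul hη).mono
    (chartSupport_subset_target I i)).integrableOn_compact (isCompact_chartSupport I i)

lemma formIntegral_congr {o : ∀ x : N, Orientation ℝ (TangentSpace I x) (Fin r)}
    {j : N → Euc n} {η η' : Euc n → Euc n [⋀^Fin r]→L[ℝ] ℝ} (h : ∀ x, η (j x) = η' (j x)) :
    formIntegral I o j η = formIntegral I o j η' := by
  simp [formIntegral, pullbackAt, h]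

lemma formIntegral_sub {o : ∀ x : N, Orientation ℝ (TangentSpace I x) (Fin r)}
    (ho : IsContinuousOrientation I o) {j : N → Euc n} {η η' : Euc n → Euc n [⋀^Fin r]→L[ℝ] ℝ}
    (hη : ∀ i, ContinuousOn (chartCoeff I j η i) (extChartAt I i).target)
    (hη' : ∀ i, ContinuousOn (chartCoeff I j η' i) (extChartAt I i).target) :
    formIntegral I o j (fun s => η s - η' s) = formIntegral I o j η - formIntegral I o j η' := by
  simp only [formIntegral_eq_sum, ← Finset.sum_sub_distrib]
  refine Finset.sum_congr rfl fun i _ => ?_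
  rw [← integral_sub (integrableOn_chartWeight_mul I ho (hη i))
    (integrableOn_chartWeight_mul I ho (hη' i))]
  congr 1 with y
  exact mul_sub _ _ _

/-- The fundamental lemma of the calculus of variations for forms of top degree: a continuous form
whose integral against every test function vanishes is zero. -/
lemma pullbackAt_eq_zero_of_formIntegral_smul_eq_zero
    {o : ∀ x : N, Orientation ℝ (TangentSpace I x) (Fin r)} (ho : IsContinuousOrientation I o)
    {j : N → Euc n} (hj : Continuous j) (hinj : Function.Injective j)
    {η : Euc n → Euc n [⋀^Fin r]→L[ℝ] ℝ}
    (hη : ∀ i, ContinuousOn (chartCoeff I j η i) (extChartAt I i).target)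
    (h : ∀ f : Euc n → ℝ, ContDiff ℝ 1 f → formIntegral I o j (fun s => f s • η s) = 0) (x : N) :
    pullbackAt I j η x = 0 := by
  by_contra hne
  obtain ⟨b, hb⟩ := exists_basis_chartFrame I (mem_chart_source H x)
  set q : N → ℝ := fun z =>
    frameSign (o z) (chartFrame I x z) * pullbackAt I j η z (chartFrame I x z) with hq
  have hqx : q x ≠ 0 := by
    refine mul_ne_zero (frameSign_ne_zero _ _) fun h0 => hne ?_
    have := (pullbackAt I j η x).toAlternatingMap.eq_smul_basis_det b
    rw [hb] at this
    ext v
    have h1 := congrArg (fun l => l v) this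
    simpa [h0] using h1
  have hqc : ContinuousAt q x := by
    refine ((continuousOn_frameSign I ho x).continuousAt
      (chart_source_mem_nhds H x)).mul ?_
    have h1 : ContinuousOn (chartCoeff I j η x ∘ extChartAt I x) (extChartAt I x).source :=
      (hη x).comp (continuousOn_extChartAt x) (extChartAt I x).mapsTo
    refine ((h1.congr fun z hz => ?_).continuousAt (extChartAt_source_mem_nhds x))
    simp only [Function.comp, chartCoeff]
    rw [(extChartAt I x).left_inv hz]
  -- multiplying by `q x` makes the integrand nonnegative near `x`, whatever the sign of the form
  have hU : ∀ᶠ z in 𝓝 x, z ∈ (chartAt H x).source ∧ 0 < q x * q z :=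
    Filter.Eventually.and (chart_source_mem_nhds H x)
      ((continuousAt_const.mul hqc).eventually_const_lt (mul_self_pos.2 hqx))
  rw [(hj.isClosedEmbedding hinj).isInducing.nhds_eq_comap, Filter.eventually_comap] at hU
  obtain ⟨δ, hδ, hball⟩ := Metric.eventually_nhds_iff_ball.1 hU
  let f : ContDiffBump (j x) := ⟨δ / 2, δ, by positivity, by linarith⟩
  have hfU : ∀ z, f (j z) ≠ 0 → z ∈ (chartAt H x).source ∧ 0 < q x * q z := fun z hz =>
    hball (j z) (by simpa [f.support_eq] using (Function.mem_support.2 hz)) z rfl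
  set F : N → Euc r → ℝ := fun i y => q x *
    (chartWeight I o i y * chartCoeff I j (fun s => f s • η s) i y) with hF
  have hring : ∀ q χ σ f l : ℝ, q * (χ * σ * (f * l)) = χ * f * (σ * (q * l)) := fun _ _ _ _ _ => by
    ring
  have hFeq : ∀ i y, F i y = chartPartition I N i ((extChartAt I i).symm y) *
      f (j ((extChartAt I i).symm y)) * (frameSign (o ((extChartAt I i).symm y))
        (chartFrame I i ((extChartAt I i).symm y)) *
        ((q x) • pullbackAt I j η ((extChartAt I i).symm y)).toAlternatingMap
          (chartFrame I i ((extChartAt I i).symm y))) := fun i y => by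
    simp only [hF, chartWeight, chartCoeff, pullbackAt_smul]
    exact hring _ _ _ _ _
  have hpos : ∀ i, ∀ z ∈ (chartAt H i).source, f (j z) ≠ 0 →
      0 < frameSign (o z) (chartFrame I i z) *
        ((q x) • pullbackAt I j η z).toAlternatingMap (chartFrame I i z) := by
    intro i z hz hfz
    obtain ⟨hzx, hqz⟩ := hfU z hfz
    obtain ⟨b₁, hb₁⟩ := exists_basis_chartFrame I hzx
    obtain ⟨b₂, hb₂⟩ := exists_basis_chartFrame I hz
    rw [← hb₂]
    refine frameSign_mul_pos (o z) b₁ b₂ _ ?_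
    rw [hb₁]
    simp only [hq] at hqz ⊢
    simp
    linarith
  have hFnonneg : ∀ i, ∀ y ∈ (extChartAt I i).target, 0 ≤ F i y := by
    intro i y hy
    rw [hFeq]
    by_cases hfy : f (j ((extChartAt I i).symm y)) = 0
    · rw [hfy, mul_zero, zero_mul]
    · exact mul_nonneg (mul_nonneg ((chartPartition I N).nonneg i _) f.nonneg)
        (hpos i _ (mapsTo_extChartAt_symm I i hy) hfy).le
  have hfη : ∀ i, ContinuousOn (chartCoeff I j (fun s => f s • η s) i) (extChartAt I i).target :=
    fun i => ((f.continuous.comp hj).comp_continuousOn (continuousOn_extChartAt_symm i)).mul (hη i)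
  have hFint : ∀ i, IntegrableOn (F i) (chartSupport I i) := fun i =>
    (integrableOn_chartWeight_mul I ho (hfη i)).const_mul (q x)
  have hFnonneg' : ∀ i, 0 ≤ᵐ[volume.restrict (chartSupport I i)] F i := fun i =>
    (ae_restrict_iff' (isCompact_chartSupport I i).measurableSet).2
      (.of_forall fun y hy => hFnonneg i y (chartSupport_subset_target I i hy))
  have hsum : ∑ i ∈ activeCharts I N, ∫ y in chartSupport I i, F i y = 0 := by
    simp only [hF, integral_const_mul, ← Finset.mul_sum, ← formIntegral_eq_sum, h f f.contDiff,
      mul_zero]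
  obtain ⟨i, hi⟩ := (chartPartition I N).exists_pos_of_mem (mem_univ x)
  have hiS : i ∈ activeCharts I N := by
    simpa [activeCharts] using Function.support_nonempty_iff.1 ⟨x, hi.ne'⟩
  have hint := (Finset.sum_eq_zero_iff_of_nonneg
    (fun i _ => integral_nonneg_of_ae (hFnonneg' i))).1 hsum i hiS
  have hae := (setIntegral_eq_zero_iff_of_nonneg_ae (hFnonneg' i) (hFint i)).1 hint
  have hxi : x ∈ (extChartAt I i).source := by
    simpa [extChartAt_source] using tsupport_chartPartition_subset I i (subset_tsupport _ hi.ne')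
  have hy : extChartAt I i x ∈ (extChartAt I i).target := (extChartAt I i).map_source hxi
  have hFy : 0 < F i (extChartAt I i x) := by
    have hfx : f (j x) = 1 := f.one_of_mem_closedBall (by simp [f.rIn_pos.le])
    rw [hFeq, (extChartAt I i).left_inv hxi]
    exact mul_pos (mul_pos hi (by simp [hfx]))
      (hpos i x (by simpa [extChartAt_source] using hxi) (by simp [hfx]))
  have hFc : ContinuousWithinAt (F i) (extChartAt I i).target (extChartAt I i x) :=
    (continuousOn_const.mul ((continuousOn_chartWeight I ho i).mul (hfη i))) _ hy
  have hev : ∀ᶠ y in 𝓝[range I] (extChartAt I i x),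
      y ∈ (extChartAt I i).target ∧ 0 < F i y := by
    have h1 : ∀ᶠ y in 𝓝[(extChartAt I i).target] (extChartAt I i x),
        y ∈ (extChartAt I i).target ∧ 0 < F i y :=
      eventually_mem_nhdsWithin.and (hFc.eventually_const_lt hFy)
    rwa [nhdsWithin_extChartAt_target_eq_of_mem hy] at h1
  -- `x` may lie on the boundary, but every neighbourhood of its coordinates meets the interior of
  -- `range I` in an open set, which has positive measure
  obtain ⟨W, hW, hyW, hWF⟩ := mem_nhdsWithin.1 hev
  have hopen : (W ∩ interior (range I)).Nonempty :=
    mem_closure_iff.1 (I.range_subset_closure_interior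
      (extChartAt_target_subset_range i hy)) W hW hyW
  have hWpos := ((hW.inter isOpen_interior).measure_pos volume hopen).ne'
  refine hWpos (measure_mono_null ?_ ((ae_restrict_iff'
    (isCompact_chartSupport I i).measurableSet).1 hae))
  intro y hyW' hy0
  obtain ⟨hyt, hFy'⟩ := hWF ⟨hyW'.1, interior_subset hyW'.2⟩
  refine hFy'.ne' (hy0 (mem_chartSupport I hyt fun h0 => ?_))
  rw [hFeq, h0] at hFy'
  simp at hFy'

end Charts

/-! ### Forms on the moving submanifold in the charts of `N` -/

section Moving

variable {n m r : ℕ} {H : Type*} [TopologicalSpace H] (I : ModelWithCorners ℝ (Euc r) H)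
  {N : Type*} [TopologicalSpace N] [ChartedSpace H N]

/-- The coordinate frame of the chart of `N` around `i`, pushed forward to `ℝⁿ` by `ι`, as a
function of the coordinates. -/
noncomputable def pushedFrame (ι : N → Euc n) (i : N) (y : Euc r) (k : Fin r) : Euc n :=
  fderivWithin ℝ (ι ∘ (extChartAt I i).symm) (range I) y (EuclideanSpace.single k (1 : ℝ))

lemma continuousOn_comp_extChartAt_symm {ι : N → Euc n} (hι : ContMDiff I 𝓘(ℝ, Euc n) ∞ ι) (i : N) :
    ContinuousOn (fun y => ι ((extChartAt I i).symm y)) (extChartAt I i).target :=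
  hι.continuous.comp_continuousOn (continuousOn_extChartAt_symm i)

variable [IsManifold I ∞ N] {M : Set (Euc n)} {V : Fin m → Euc n → Euc n}
  {φ : (Fin m → ℝ) → Euc n → Euc n} {ι : N → Euc n}
  {ρ : (Fin m → ℝ) → Euc n → Euc n [⋀^Fin r]→L[ℝ] ℝ}

lemma continuousOn_pushedFrame (hι : ContMDiff I 𝓘(ℝ, Euc n) ∞ ι) (i : N) :
    ContinuousOn (pushedFrame I ι i) (extChartAt I i).target := by
  have hcd : ContDiffOn ℝ ∞ (ι ∘ (extChartAt I i).symm) (extChartAt I i).target :=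
    (hι.comp_contMDiffOn (contMDiffOn_extChartAt_symm i)).contDiffOn
  have hfd := hcd.continuousOn_fderivWithin (uniqueDiffOn_extChartAt_target i) (by simp)
  refine continuousOn_pi.2 fun k => ((hfd.congr fun y hy => ?_).clm_apply continuousOn_const)
  exact (fderivWithin_congr_set (extChartAt_target_eventuallyEq_of_mem hy)).symm

lemma mfderiv_chartFrame (hι : ContMDiff I 𝓘(ℝ, Euc n) ∞ ι) {i : N} {y : Euc r}
    (hy : y ∈ (extChartAt I i).target) (k : Fin r) :
    mfderiv I 𝓘(ℝ, Euc n) ι ((extChartAt I i).symm y)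
      (chartFrame I i ((extChartAt I i).symm y) k) = pushedFrame I ι i y k := by
  have : IsManifold I 1 N := IsManifold.of_le (n := ∞) ENat.LEInfty.out
  have h := mfderiv_comp_mfderivWithin (I := 𝓘(ℝ, Euc r)) (I' := I) (I'' := 𝓘(ℝ, Euc n)) y
    (hι.mdifferentiableAt (by simp) (x := (extChartAt I i).symm y))
    (mdifferentiableWithinAt_extChartAt_symm hy)
    (I.uniqueDiffOn.uniqueMDiffOn y (extChartAt_target_subset_range i hy))
  rw [pushedFrame, ← mfderivWithin_eq_fderivWithin, h, chartFrame,
    (extChartAt I i).right_inv hy]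
  rfl

/-- In a chart, a form on the moving submanifold is read off on the fixed frame `pushedFrame`,
transported by the Jacobian of the flow. -/
lemma chartCoeff_flow_comp (hφ : IsParamFlow M V φ) (hM : IsOpen M)
    (hι : ContMDiff I 𝓘(ℝ, Euc n) ∞ ι) (hιM : ∀ x, ι x ∈ M) (C : Fin m → ℝ)
    (η : Euc n → Euc n [⋀^Fin r]→L[ℝ] ℝ) {i : N} {y : Euc r}
    (hy : y ∈ (extChartAt I i).target) :
    chartCoeff I (φ C ∘ ι) η i y = η (φ C (ι ((extChartAt I i).symm y)))
      (fun k => fderiv ℝ (φ C) (ι ((extChartAt I i).symm y)) (pushedFrame I ι i y k)) := by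
  have h := mfderiv_comp (I := I) (I' := 𝓘(ℝ, Euc n)) (I'' := 𝓘(ℝ, Euc n))
    ((extChartAt I i).symm y) (hφ.differentiableAt hM C (hιM _)).mdifferentiableAt
    (hι.mdifferentiableAt (by simp) (x := (extChartAt I i).symm y))
  rw [chartCoeff, pullbackAt, h, mfderiv_eq_fderiv]
  simp_rw [← mfderiv_chartFrame I hι hy]
  rfl

/-- The Lie derivative of a `C¹` family is continuous along the submanifold, because it is a partial
derivative of `pulledBackValue`. -/
lemma continuousOn_chartCoeff_lieDeriv (hφ : IsParamFlow M V φ) (hM : IsOpen M)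
    (hι : ContMDiff I 𝓘(ℝ, Euc n) ∞ ι) (hιM : ∀ x, ι x ∈ M)
    (hρ : ∀ C, ∀ x : N,
      ContDiffAt ℝ 1 (fun q : (Fin m → ℝ) × Euc n => ρ q.1 q.2) (C, φ C (ι x)))
    (C : Fin m → ℝ) (c : Fin m) (i : N) :
    ContinuousOn (chartCoeff I (φ C ∘ ι) (lieDeriv φ ρ C c) i) (extChartAt I i).target := by
  have hg : ∀ C, ∀ y ∈ (extChartAt I i).target, ContDiffAt ℝ 1 (pulledBackValue φ ρ)
      (C, ι ((extChartAt I i).symm y), pushedFrame I ι i y) := fun C y _ =>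
    hφ.contDiffAt_pulledBackValue hM (hιM _) _ (hρ C _)
  have h := (continuousOn_fderiv_parameter
    ((continuousOn_comp_extChartAt_symm I hι i).prodMk (continuousOn_pushedFrame I hι i)) hg).comp
    (f := fun y => (C, y)) (s := (extChartAt I i).target) (by fun_prop) (fun y hy => ⟨trivial, hy⟩)
  refine (h.clm_apply (continuousOn_const (c := (Pi.single c 1, 0)))).congr fun y hy => ?_
  rw [chartCoeff_flow_comp I hφ hM hι hιM C _ hy]
  exact (hφ.fderiv_pulledBackValue hM (hιM _) _ (hρ C _) c).symm

variable [T2Space N] [CompactSpace N]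
  {o : ∀ x : N, Orientation ℝ (TangentSpace I x) (Fin r)}

/-- Transport theorem: the integral of a family of forms over the moving submanifold has the
integral of the Lie derivative as its derivative. -/
lemma hasFDerivAt_formIntegral (ho : IsContinuousOrientation I o) (hφ : IsParamFlow M V φ)
    (hM : IsOpen M) (hι : ContMDiff I 𝓘(ℝ, Euc n) ∞ ι) (hιM : ∀ x, ι x ∈ M)
    (hρ : ∀ C, ∀ x : N,
      ContDiffAt ℝ 1 (fun q : (Fin m → ℝ) × Euc n => ρ q.1 q.2) (C, φ C (ι x)))
    (C : Fin m → ℝ) :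
    HasFDerivAt (fun C => formIntegral I o (φ C ∘ ι) (ρ C))
      (∑ c, formIntegral I o (φ C ∘ ι) (lieDeriv φ ρ C c) •
        (ContinuousLinearMap.proj c : (Fin m → ℝ) →L[ℝ] ℝ)) C := by
  have hint := fun i : N => hasFDerivAt_setIntegral_of_contDiffAt (μ := volume)
    (isCompact_chartSupport I i) (a := chartWeight I o i)
    (z := fun y => (ι ((extChartAt I i).symm y), pushedFrame I ι i y)) (g := pulledBackValue φ ρ)
    ((continuousOn_chartWeight I ho i).mono (chartSupport_subset_target I i))
    (((continuousOn_comp_extChartAt_symm I hι i).prodMk (continuousOn_pushedFrame I hι i)).mono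
      (chartSupport_subset_target I i))
    (fun C y _ => hφ.contDiffAt_pulledBackValue hM (hιM _) _ (hρ C _)) C
  have hsum := HasFDerivAt.fun_sum (u := activeCharts I N) fun i _ => (hint i).2
  refine (hsum.congr_fderiv ?_).congr_of_eventuallyEq (.of_forall fun C' => ?_)
  · refine ContinuousLinearMap.coe_injective (LinearMap.pi_ext' fun c => ?_)
    ext
    simp only [LinearMap.comp_apply, LinearMap.single_apply, ContinuousLinearMap.coe_coe,
      sum_apply, smul_apply, ContinuousLinearMap.proj_apply,
      smul_eq_mul]
    rw [Finset.sum_eq_single c (by intro b _ hb; simp [Pi.single_eq_of_ne hb]) (by simp),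
      Pi.single_eq_same, mul_one, formIntegral_eq_sum]
    refine Finset.sum_congr rfl fun i _ => ?_
    rw [ContinuousLinearMap.integral_apply (hint i).1]
    refine setIntegral_congr_fun (isCompact_chartSupport I i).measurableSet fun y hy => ?_
    rw [chartCoeff_flow_comp I hφ hM hι hιM C _ (chartSupport_subset_target I i hy),
      ← hφ.fderiv_pulledBackValue hM (hιM _) _ (hρ C _) c]
    rfl
  · refine (formIntegral_eq_sum I o _ _).trans (Finset.sum_congr rfl fun i _ =>
      setIntegral_congr_fun (isCompact_chartSupport I i).measurableSet fun y hy => ?_)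
    rw [chartCoeff_flow_comp I hφ hM hι hιM C' _ (chartSupport_subset_target I i hy)]
    rfl

/-- The derivative of the expectation of `β` is the expectation of `dβ` plus the integral of `β`
against the Lie derivative of the probability form. -/
lemma hasFDerivAt_expectation (ho : IsContinuousOrientation I o) (hφ : IsParamFlow M V φ)
    (hM : IsOpen M) (hι : ContMDiff I 𝓘(ℝ, Euc n) ∞ ι) (hιM : ∀ x, ι x ∈ M)
    (hρ : ∀ C, ∀ x : N,
      ContDiffAt ℝ 1 (fun q : (Fin m → ℝ) × Euc n => ρ q.1 q.2) (C, φ C (ι x)))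
    {β : (Fin m → ℝ) → Euc n → ℝ}
    (hβ : ∀ C, ∀ x : N,
      ContDiffAt ℝ 1 (fun q : (Fin m → ℝ) × Euc n => β q.1 q.2) (C, φ C (ι x)))
    (C : Fin m → ℝ) :
    HasFDerivAt (fun C' => expectation I o φ ι ρ C' (β C'))
      (expectationDiff I o V φ ι ρ β C +
        ∑ c, formIntegral I o (φ C ∘ ι) (fun s => β C s • lieDeriv φ ρ C c s) •
          (ContinuousLinearMap.proj c : (Fin m → ℝ) →L[ℝ] ℝ)) C := by
  have hβρ : ∀ C, ∀ x : N, ContDiffAt ℝ 1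
      (fun q : (Fin m → ℝ) × Euc n => β q.1 q.2 • ρ q.1 q.2) (C, φ C (ι x)) := fun C x =>
    (hβ C x).smul (hρ C x)
  refine (hasFDerivAt_formIntegral I ho hφ hM hι hιM (ρ := fun C s => β C s • ρ C s)
    hβρ C).congr_fderiv ?_
  -- By the Leibniz rule the integrals of `L(β ρ)` and of `β L ρ` differ by `⟨dβ⟩`; taking the
  -- difference spares the integrability of `dβ` itself.
  rw [expectationDiff, ← Finset.sum_add_distrib]
  refine Finset.sum_congr rfl fun c _ => ?_
  rw [← add_smul]
  congr 1
  have hβc : Continuous fun x : N => β C (φ C (ι x)) := by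
    refine continuous_iff_continuousAt.2 fun x => ?_
    have h1 : ContinuousAt (fun x : N => (C, φ C (ι x))) x :=
      continuousAt_const.prodMk (ContinuousAt.comp (g := φ C)
        (hφ.differentiableAt hM C (hιM x)).continuousAt hι.continuous.continuousAt)
    exact ContinuousAt.comp (f := fun x : N => (C, φ C (ι x)))
      (g := fun q : (Fin m → ℝ) × Euc n => β q.1 q.2)
      (hβ C x).continuousAt h1
  have hcont : ∀ i, ContinuousOn (chartCoeff I (φ C ∘ ι)
      (fun s => β C s • lieDeriv φ ρ C c s) i) (extChartAt I i).target := fun i =>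
    (hβc.comp_continuousOn (continuousOn_extChartAt_symm i)).mul
      (continuousOn_chartCoeff_lieDeriv I hφ hM hι hιM hρ C c i)
  rw [expectation, ← sub_eq_iff_eq_add, ← formIntegral_sub I ho
    (continuousOn_chartCoeff_lieDeriv I hφ hM hι hιM hβρ C c) hcont]
  refine formIntegral_congr I fun x => ?_
  rw [Function.comp_apply, hφ.lieDeriv_smul hM (hφ.mapsTo C (hιM x))
    ((hρ C x).differentiableAt (by simp)) ((hβ C x).differentiableAt (by simp)),
    add_sub_cancel_right]

end Moving

/-- `M ⊆ ℝⁿ` is open, `φ` the `m`-parameter flow of `V` on `M`, `Ω(0) = ι(N) ⊆ M` an oriented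
compact `r`-dimensional submanifold (with or without boundary), `Ω(C) = φ^C (Ω(0))`, and `ρ` a
probability `r`-form on `Ω(C)`.  The multiparameter Lie derivative of `ρ` exists and is given by
Cartan's formula (with the term `∂ρ/∂C_c`, which is zero if `ρ` does not depend explicitly on `C`);
and `d⟨β⟩ = ⟨dβ⟩` for every `C¹` function `β` if and only if that Lie derivative vanishes, as an
`r`-form on `Ω(C)`, at every point of `Ω(C)`, for every `C`. -/
theorem theorem2 {n m r : ℕ} {H : Type*} [TopologicalSpace H]
    (I : ModelWithCorners ℝ (Euc r) H)
    {N : Type*} [TopologicalSpace N] [ChartedSpace H N] [T2Space N] [CompactSpace N]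
    [IsManifold I ∞ N]
    (o : ∀ x : N, Orientation ℝ (TangentSpace I x) (Fin r)) (ho : IsContinuousOrientation I o)
    (M : Set (Euc n)) (hM : IsOpen M)
    (V : Fin m → Euc n → Euc n) (φ : (Fin m → ℝ) → Euc n → Euc n) (hφ : IsParamFlow M V φ)
    (ι : N → Euc n) (hι : Manifold.IsSmoothEmbedding I 𝓘(ℝ, Euc n) ∞ ι) (hιM : ∀ x, ι x ∈ M)
    (ρ : (Fin m → ℝ) → Euc n → Euc n [⋀^Fin r]→L[ℝ] ℝ)
    (hρ : IsProbabilityForm I o φ ι ρ) :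
    (∀ (C : Fin m → ℝ) (c : Fin m) (x : N),
      DifferentiableAt ℝ (pullbackCurve φ ρ C c (φ C (ι x))) 0 ∧
      lieDeriv φ ρ C c (φ C (ι x)) =
        paramDeriv ρ C c (φ C (ι x)) + interiorExtDeriv (V c) (ρ C) (φ C (ι x)) +
          extDerivInterior (V c) (ρ C) (φ C (ι x))) ∧
    ((∀ β : (Fin m → ℝ) → Euc n → ℝ,
        (∀ (C : Fin m → ℝ) (x : N),
          ContDiffAt ℝ 1 (fun q : (Fin m → ℝ) × Euc n => β q.1 q.2) (C, φ C (ι x))) →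
        ∀ C : Fin m → ℝ,
          HasFDerivAt (fun C' => expectation I o φ ι ρ C' (β C'))
            (expectationDiff I o V φ ι ρ β C) C) ↔
      ∀ (C : Fin m → ℝ) (c : Fin m) (x : N),
        pullbackAt I (φ C ∘ ι) (lieDeriv φ ρ C c) x = 0) := by
  have hρ1 := hρ.contDiffAt
  have hιs := hι.contMDiff
  refine ⟨fun C c x => ?_, fun h C c x => ?_, fun h β hβ C => ?_⟩
  · have hs := hφ.mapsTo C (hιM x)
    have hd := (hρ1 C x).differentiableAt (by simp)
    exact ⟨(hφ.hasDerivAt_pullbackCurve hM hs hd c).differentiableAt, hφ.lieDeriv_eq hM hs hd c⟩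
  · have hj : Continuous (φ C ∘ ι) := continuous_iff_continuousAt.2 fun x =>
      (hφ.differentiableAt hM C (hιM x)).continuousAt.comp hιs.continuous.continuousAt
    have hinj : Function.Injective (φ C ∘ ι) := fun x y hxy =>
      hι.isEmbedding.injective (hφ.injOn C (hιM x) (hιM y) hxy)
    refine pullbackAt_eq_zero_of_formIntegral_smul_eq_zero I ho hj hinj
      (continuousOn_chartCoeff_lieDeriv I hφ hM hιs hιM hρ1 C c) (fun f hf => ?_) x
    -- test functions that do not depend on the parameter are enough
    have hβ : ∀ (C : Fin m → ℝ) (x : N),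
        ContDiffAt ℝ 1 (fun q : (Fin m → ℝ) × Euc n => f q.2) (C, φ C (ι x)) := fun C x =>
      (hf.comp contDiff_snd).contDiffAt
    have hzero := (hasFDerivAt_expectation I ho hφ hM hιs hιM hρ1 (β := fun _ => f) hβ C).unique
      (h (fun _ => f) hβ C)
    have happ := congrArg (fun L : (Fin m → ℝ) →L[ℝ] ℝ => L (Pi.single c 1))
      (add_eq_left.1 hzero)
    simpa [Pi.single_apply] using happ
  · have hzero : ∀ c, formIntegral I o (φ C ∘ ι) (fun s => β C s • lieDeriv φ ρ C c s) = 0 :=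
      fun c => by
        rw [formIntegral_eq_sum]
        refine Finset.sum_eq_zero fun i _ => ?_
        have hcoeff : ∀ y, chartCoeff I (φ C ∘ ι) (fun s => β C s • lieDeriv φ ρ C c s) i y = 0 :=
          fun y => by
            rw [chartCoeff, pullbackAt_smul, h C c, smul_zero]
            rfl
        simp [hcoeff]
    simpa [hzero] using hasFDerivAt_expectation I ho hφ hM hιs hιM hρ1 hβ C
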